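/- Let $(\Omega,\mathcal F,\mathbb P)$ be a probability space carrying a Poisson process $N$ with intensity $\lambda>0$ and jump times $T_1,T_2,\dots$, and i.i.d. claim sizes $Y_1,Y_2,\dots$, independent of $N$, with a continuous distribution function $F_Y$ such that $F_Y(0)=0$, and with $\mathbb E[Y_1^2]<\infty$. Let $Z_t=\sum_{j=1}^{N_t}Y_j$ and let $(\mathcal F^Z_t)_{t\ge 0}$ be its natural filtration. Let $T>0$ be the maturity, $\mathcal S>0$ a waiting time, $m_1,m_2\ge 0$ deductibles, $c\in\mathbb R$ an income rate, and let the premium rates $s\mapsto\pi_i(s,m_i)$, $i\in\{1,2\}$, be measurable with $0\le\pi_i(s,m_i)<c$ for all $s\ge 0$. Let $h:\mathbb R\to\mathbb R$ be Lipschitz continuous. An admissible barrier strategy is an $(\mathcal F^Z_t)$-predictable process $b=(b_u)$ with values in $[0,\infty)$; $\mathcal B(t)$ denotes the set of such strategies on $[t,T]$. Given $b\in\mathcal B(t)$ and an initial state $(I_t,S_t,X_t)=(i,s,x)$, consisting of the class, the time since the last report and the wealth, the controlled process $(I_u,S_u,X_u)_{t\le u\le T}$ evolves as follows. Between claims, $\mathrm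 dS_u=\mathrm du$ and $\mathrm dX_u=(c-\pi_{I_u}(S_u,m_{I_u}))\,\mathrm du$, with $I$ constant, except that whenever $I=2$ and $S$ reaches (or starts at) $\mathcal S$, the state $(2,\mathcal S,X)$ is replaced at once by $(1,0,X)$. At a claim time $u=T_j\in(t,T]$ with size $Y_j$: if $Y_j\le b_u$, the claim is not reported and $X$ decreases by $Y_j$, while $I$ and $S$ do not change; if $Y_j>b_u$, the claim is reported, $X$ decreases by $\min(Y_j,m_{I_{u-}})$, and $(I_u,S_u)=(2,0)$. Let $$D_1=\{(t,s,x): 0\le s\le t\le T,\ x\in\mathbb R\},\qquad D_2=\{(t,s,x)\in D_1: s\le\mathcal S\},$$ and for $i\in\{1,2\}$ and $(t,s,x)\in D_i$ let $$V(i,t,s,x)=\sup_{b\in\mathcal B(t)}\mathbb E_{i,t,s,x}\big[h(X_T)\big],$$ where $\mathbb E_{i,t,s,x}$ means that the controlled process starts at time $t$ in the state $(i,s,x)$. Then all these expectations exist, the supremum is finite, and for each $i\in\{1,2\}$ the map $(t,s,x)\mapsto V(i,t,s,x)$ is Lipschitz continuous on $D_i$, jointly in its three variables. -/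

import Mathlib

open MeasureTheory ProbabilityTheory Set
open scoped NNReal

namespace BonusMalus

/-! ### The claim process -/

section Claims

variable {Ω : Type*} [MeasurableSpace Ω]

/-- `N` is a (homogeneous) Poisson process with intensity `rate`: a counting process started at
`0` with nondecreasing right-continuous paths and independent, Poisson distributed increments.
The topology on `ℕ` is discrete. -/
structure IsPoissonProcess (N : ℝ≥0 → Ω → ℕ) (rate : ℝ≥0) (P : Measure Ω) : Prop where
  measurable : ∀ t, Measurable (N t)
  zero : ∀ ω, N 0 ω = 0
  mono : ∀ ω, Monotone fun t => N t ω
  rightCts : ∀ ω t, ContinuousWithinAt (fun u => N u ω) (Ici t) t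
  indepIncrements : HasIndepIncrements N P
  law : ∀ s t, s ≤ t → P.map (fun ω => N t ω - N s ω) = poissonMeasure (rate * (t - s))

/-- The claim arrivals `N` form a Poisson process, and the claim sizes `Y` are i.i.d., independent
of `N`, with a continuous distribution function that vanishes at `0` and with finite second
moment. The claims are numbered from `0`. -/
structure IsClaimModel (N : ℝ≥0 → Ω → ℕ) (Y : ℕ → Ω → ℝ) (rate : ℝ≥0) (P : Measure Ω) :
    Prop where
  poisson : IsPoissonProcess N rate P
  measurable_size : ∀ j, Measurable (Y j)
  indep_size : iIndepFun Y P
  identDistrib_size : ∀ j, IdentDistrib (Y j) (Y 0) P P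
  continuous_cdf : Continuous (cdf (P.map (Y 0)))
  cdf_zero : cdf (P.map (Y 0)) 0 = 0
  secondMoment : Integrable (fun ω => Y 0 ω ^ 2) P
  indep : IndepFun (fun ω j => Y j ω) (fun ω t => N t ω) P

/-- The time of the claim with number `j` (numbered from `0`). It is only used for claims that do
occur, that is, when the set is nonempty. -/
noncomputable def claimTime (N : ℝ≥0 → Ω → ℕ) (j : ℕ) (ω : Ω) : ℝ≥0 :=
  sInf {u : ℝ≥0 | j < N u ω}

/-- The compound Poisson process of aggregated claims. -/
noncomputable def aggregateClaims (N : ℝ≥0 → Ω → ℕ) (Y : ℕ → Ω → ℝ) (t : ℝ≥0) (ω : Ω) : ℝ :=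
  ∑ j ∈ Finset.range (N t ω), Y j ω

theorem measurable_aggregateClaims {N : ℝ≥0 → Ω → ℕ} {Y : ℕ → Ω → ℝ}
    (hN : ∀ t, Measurable (N t)) (hY : ∀ j, Measurable (Y j)) (t : ℝ≥0) :
    Measurable (aggregateClaims N Y t) := by
  have h : Measurable fun p : Ω × ℕ => ∑ j ∈ Finset.range p.2, Y j p.1 :=
    measurable_from_prod_countable_left fun n =>
      Finset.measurable_fun_sum (Finset.range n) fun j _ => hY j
  exact h.comp (measurable_id.prodMk (hN t))

/-- The natural filtration of the aggregated claims. -/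
noncomputable def claimFiltration {N : ℝ≥0 → Ω → ℕ} {Y : ℕ → Ω → ℝ} {rate : ℝ≥0} {P : Measure Ω}
    (hM : IsClaimModel N Y rate P) : Filtration ℝ≥0 ‹MeasurableSpace Ω› :=
  Filtration.natural (aggregateClaims N Y) fun t =>
    (measurable_aggregateClaims hM.poisson.measurable hM.measurable_size t).stronglyMeasurable

/-- The admissible barrier strategies: nonnegative processes that are predictable with respect to
the natural filtration of the aggregated claims. A strategy on `[t, T]` is the restriction of such
a process, and the wealth of a policyholder observed from `t` to `T` depends on no other values. -/
def barrierStrategies {N : ℝ≥0 → Ω → ℕ} {Y : ℕ → Ω → ℝ} {rate : ℝ≥0} {P : Measure Ω}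
    (hM : IsClaimModel N Y rate P) : Set (ℝ≥0 → Ω → ℝ≥0) :=
  {b | IsStronglyPredictable (claimFiltration hM) b}

end Claims

/-! ### The contract and the controlled process -/

/-- The two insurance classes. -/
inductive InsClass
  | C1
  | C2

/-- The data of the contract: income rate, premium rates `premium i s m` (class, time since the
last report, deductible), the deductible of each class, and the time without a report after which
the policyholder leaves class 2. -/
structure Contract where
  income : ℝ
  premium : InsClass → ℝ → ℝ → ℝ
  deductible : InsClass → ℝ
  waiting : ℝ

/-- A state `(I, S, X)` of the policyholder: class, time since the last report, wealth. -/
structure State where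
  cls : InsClass
  dur : ℝ
  wealth : ℝ

namespace Contract

variable (C : Contract)

/-- The rate at which wealth changes between claims. -/
def drift (i : InsClass) (s : ℝ) : ℝ := C.income - C.premium i s (C.deductible i)

/-- The evolution over a time span `d` in which no claim occurs. In class 2 the policyholder moves
to class 1, and the clock is reset to zero, at the moment when the clock reaches `waiting`. -/
noncomputable def flow (d : ℝ) : State → State
  | ⟨.C1, s, x⟩ => ⟨.C1, s + d, x + ∫ v in s..(s + d), C.drift .C1 v⟩
  | ⟨.C2, s, x⟩ =>
    if s + d < C.waiting then
      ⟨.C2, s + d, x + ∫ v in s..(s + d), C.drift .C2 v⟩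
    else
      ⟨.C1, s + d - C.waiting,
        x + (∫ v in s..C.waiting, C.drift .C2 v)
          + ∫ v in (0 : ℝ)..(s + d - C.waiting), C.drift .C1 v⟩

/-- The effect of a claim of size `y` under the barrier `β`: a claim `y ≤ β` is not reported and
paid by the policyholder; a claim `y > β` is reported, which costs `min y m` with the deductible
`m` of the current class, and puts the policyholder at the start of class 2. -/
noncomputable def claim (z : State) (y β : ℝ) : State :=
  if y ≤ β then ⟨z.cls, z.dur, z.wealth - y⟩
  else ⟨.C2, 0, z.wealth - min y (C.deductible z.cls)⟩

/-- The claims with numbers `n₀, n₀ + 1, …` hit a policyholder who is in state `z` at time `t`;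
claim `j` has time `τ j` and size `y j`, and `β` is the barrier. The value at `k` is the time of
the `k`-th of these claims and the state right after it (for `k = 0`: the pair `(t, z)`). -/
noncomputable def afterClaims (τ : ℕ → ℝ≥0) (y : ℕ → ℝ) (β : ℝ≥0 → ℝ≥0) (n₀ : ℕ)
    (t : ℝ≥0) (z : State) : ℕ → ℝ≥0 × State
  | 0 => (t, z)
  | k + 1 =>
    let p := afterClaims τ y β n₀ t z k
    let r := τ (n₀ + k)
    (r, C.claim (C.flow ((r : ℝ) - p.1) p.2) (y (n₀ + k)) (β r))

variable {Ω : Type*} [MeasurableSpace Ω]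

/-- The controlled process `(I_u, S_u, X_u)`, `u ≥ t`, started at time `t` in state `z`: the claims
that occur in `(t, u]` are applied in turn, with the claim-free evolution in between and after. -/
noncomputable def controlledState (N : ℝ≥0 → Ω → ℕ) (Y : ℕ → Ω → ℝ) (b : ℝ≥0 → Ω → ℝ≥0)
    (t : ℝ≥0) (z : State) (u : ℝ≥0) (ω : Ω) : State :=
  let p := C.afterClaims (fun j => claimTime N j ω) (fun j => Y j ω) (fun v => b v ω) (N t ω) t z
    (N u ω - N t ω)
  C.flow ((u : ℝ) - p.1) p.2

/-- The wealth `X_T` at maturity of a policyholder who is in state `(i, s, x)` at time `t`. -/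
noncomputable def terminalWealth (N : ℝ≥0 → Ω → ℕ) (Y : ℕ → Ω → ℝ) (T : ℝ≥0)
    (i : InsClass) (t : ℝ≥0) (s x : ℝ) (b : ℝ≥0 → Ω → ℝ≥0) (ω : Ω) : ℝ :=
  (C.controlledState N Y b t ⟨i, s, x⟩ T ω).wealth

/-- The functional `J(i, t, s, x, b) = E_{i,t,s,x}[h(X_T)]`. -/
noncomputable def payoff (P : Measure Ω) (N : ℝ≥0 → Ω → ℕ) (Y : ℕ → Ω → ℝ) (T : ℝ≥0) (h : ℝ → ℝ)
    (i : InsClass) (t : ℝ≥0) (s x : ℝ) (b : ℝ≥0 → Ω → ℝ≥0) : ℝ :=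
  ∫ ω, h (C.terminalWealth N Y T i t s x b ω) ∂P

/-- The value function `V(i, t, s, x)`, the supremum of `J` over the barrier strategies. -/
noncomputable def value {P : Measure Ω} {N : ℝ≥0 → Ω → ℕ} {Y : ℕ → Ω → ℝ} {rate : ℝ≥0}
    (hM : IsClaimModel N Y rate P) (T : ℝ≥0) (h : ℝ → ℝ)
    (i : InsClass) (t : ℝ≥0) (s x : ℝ) : ℝ :=
  sSup (C.payoff P N Y T h i t s x '' barrierStrategies hM)

/-- The domain of `(t, s, x) ↦ V(i, t, s, x)`: `0 ≤ s ≤ t ≤ T`, and `s ≤ waiting` in class 2. -/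
def domain (T : ℝ≥0) (i : InsClass) : Set (ℝ≥0 × ℝ × ℝ) :=
  {p | 0 ≤ p.2.1 ∧ p.2.1 ≤ p.1 ∧ p.1 ≤ T ∧ (i = .C2 → p.2.1 ≤ C.waiting)}

end Contract

end BonusMalus

/-!
Put the clocks of the two classes on one line: class 2 occupies `[-waiting, 0)` and class 1
occupies `[0, ∞)`. Between claims the policyholder then moves along this line at unit speed, also
through the change of class, and the wealth changes by the increment of a Lipschitz potential. A
policyholder is thus described by a characteristic `(θ, w)`, namely the time at which the clock
line is at `0` and the wealth at that time, which only changes at claims.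

A claim moves the characteristic by at most its size plus a constant, so ignoring the claims in
`(t, t']` costs `O(t' - t)` in the mean. Consider next two policyholders who start at the same time
from different characteristics and use the same barriers. Unreported claims cost them the same, and
the first reported claim puts both at the start of class 2, after which they never separate again.
Their deductibles for that claim can only differ if a claim falls between the two values of `θ`,
which happens with probability `O(|θ - θ'|)`. These bounds are uniform in the barrier strategy and
therefore carry over to the supremum.
-/

namespace BonusMalus

namespace Contract

variable (C : Contract)

/-! ### Characteristics -/

/-- The position of class `i` with clock `s` on the clock line, on which the clock of class 2 runs
through `[-waiting, 0)` and the clock of class 1 through `[0, ∞)`. -/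
def clockCoord : InsClass → ℝ → ℝ
  | .C1, s => s
  | .C2, s => s - C.waiting

/-- The class at the point `σ` of the clock line. -/
noncomputable def lineClass (σ : ℝ) : InsClass := if σ < 0 then .C2 else .C1

/-- The clock at the point `σ` of the clock line; it is negative for `σ < -waiting`. -/
noncomputable def lineClock (σ : ℝ) : ℝ := if σ < 0 then σ + C.waiting else σ

/-- The drift as a function on the clock line, with negative clocks replaced by `0`. -/
noncomputable def lineDrift (σ : ℝ) : ℝ := C.drift (lineClass σ) (max 0 (C.lineClock σ))

/-- The wealth gained between claims, as a potential on the clock line that vanishes at `0`. -/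
noncomputable def lineGain (σ : ℝ) : ℝ := ∫ v in (0 : ℝ)..σ, C.lineDrift v

/-- The characteristic `(θ, w)` of a policyholder who is in state `z` at time `t`, which does not
change between claims: the position on the clock line is `0` at time `θ`, and the wealth is then
`w`. -/
noncomputable def characteristic (t : ℝ) (z : State) : ℝ × ℝ :=
  (t - C.clockCoord z.cls z.dur, z.wealth - C.lineGain (C.clockCoord z.cls z.dur))

/-- The state at time `u` of a policyholder with characteristic `q`. -/
noncomputable def stateAt (q : ℝ × ℝ) (u : ℝ) : State :=
  ⟨lineClass (u - q.1), C.lineClock (u - q.1), q.2 + C.lineGain (u - q.1)⟩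

/-- The characteristic after a claim of size `y` at time `r` under the barrier `β`. -/
noncomputable def charClaim (r y β : ℝ) (q : ℝ × ℝ) : ℝ × ℝ :=
  C.characteristic r (C.claim (C.stateAt q r) y β)

/-- The characteristic after the claims with numbers `n₀, …, n₀ + k - 1`, the counterpart of
`afterClaims`. -/
noncomputable def charAfterClaims (τ : ℕ → ℝ≥0) (y : ℕ → ℝ) (β : ℝ≥0 → ℝ≥0) (n₀ : ℕ)
    (q : ℝ × ℝ) : ℕ → ℝ × ℝ
  | 0 => q
  | k + 1 =>
    C.charClaim (τ (n₀ + k)) (y (n₀ + k)) (β (τ (n₀ + k))) (charAfterClaims τ y β n₀ q k)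

variable {C}

theorem lineClass_of_neg {σ : ℝ} (hσ : σ < 0) : lineClass σ = .C2 := if_pos hσ

theorem lineClass_of_nonneg {σ : ℝ} (hσ : 0 ≤ σ) : lineClass σ = .C1 := if_neg hσ.not_gt

theorem lineClock_of_neg {σ : ℝ} (hσ : σ < 0) : C.lineClock σ = σ + C.waiting := if_pos hσ

theorem lineClock_of_nonneg {σ : ℝ} (hσ : 0 ≤ σ) : C.lineClock σ = σ := if_neg hσ.not_gt

theorem clockCoord_lineClass_lineClock (σ : ℝ) :
    C.clockCoord (lineClass σ) (C.lineClock σ) = σ := by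
  unfold lineClass lineClock
  split_ifs <;> simp [clockCoord]

theorem neg_waiting_le_clockCoord (hw : 0 < C.waiting) {z : State} (hz : 0 ≤ z.dur) :
    -C.waiting ≤ C.clockCoord z.cls z.dur := by
  rcases z with ⟨_ | _, s, x⟩ <;> simp only [clockCoord] at hz ⊢ <;> linarith

theorem characteristic_stateAt (q : ℝ × ℝ) (u : ℝ) : C.characteristic u (C.stateAt q u) = q := by
  simp [characteristic, stateAt, clockCoord_lineClass_lineClock]

theorem stateAt_characteristic {z : State} (hz : 0 ≤ z.dur)
    (hz2 : z.cls = .C2 → z.dur < C.waiting) (u : ℝ) : C.stateAt (C.characteristic u z) u = z := by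
  rcases z with ⟨_ | _, s, x⟩
  · simp [stateAt, characteristic, clockCoord, lineClass_of_nonneg hz, lineClock_of_nonneg hz]
  · have hσ : s - C.waiting < 0 := sub_neg.2 (hz2 rfl)
    simp [stateAt, characteristic, clockCoord, lineClass_of_neg hσ, lineClock_of_neg hσ]

theorem charClaim_of_le {r y β : ℝ} (h : y ≤ β) (q : ℝ × ℝ) :
    C.charClaim r y β q = (q.1, q.2 - y) := by
  simp only [charClaim, claim, h, if_true, characteristic, stateAt, clockCoord_lineClass_lineClock,
    sub_sub_cancel]
  congr 1
  ring

theorem charClaim_of_lt {r y β : ℝ} (h : β < y) (q : ℝ × ℝ) :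
    C.charClaim r y β q = (r + C.waiting, q.2 + C.lineGain (r - q.1) - C.lineGain (-C.waiting)
      - min y (C.deductible (lineClass (r - q.1)))) := by
  simp only [charClaim, claim, h.not_ge, if_false, characteristic, stateAt, clockCoord, zero_sub,
    sub_neg_eq_add]
  congr 1
  ring

theorem charClaim_fst_le {r : ℝ} {q : ℝ × ℝ} (hq : q.1 ≤ r + C.waiting) (y β : ℝ) :
    (C.charClaim r y β q).1 ≤ r + C.waiting := by
  rcases le_or_gt y β with h | h
  · rwa [charClaim_of_le h]
  · rw [charClaim_of_lt h]

theorem claim_stateAt (hw : 0 < C.waiting) (r y β : ℝ) (q : ℝ × ℝ) :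
    C.claim (C.stateAt q r) y β = C.stateAt (C.charClaim r y β q) r := by
  rcases le_or_gt y β with h | h
  · simp only [charClaim_of_le h, claim, h, if_true, stateAt]
    congr 1
    ring
  · have hclaim : C.claim (C.stateAt q r) y β =
        ⟨.C2, 0, (C.stateAt q r).wealth - min y (C.deductible (C.stateAt q r).cls)⟩ :=
      if_neg h.not_ge
    rw [charClaim, hclaim, stateAt_characteristic le_rfl fun _ => hw]

section Claims

variable {τ : ℕ → ℝ≥0} {y : ℕ → ℝ} {β : ℝ≥0 → ℝ≥0}

theorem charAfterClaims_add (n : ℕ) (q : ℝ × ℝ) (k l : ℕ) :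
    C.charAfterClaims τ y β n q (k + l) =
      C.charAfterClaims τ y β (n + k) (C.charAfterClaims τ y β n q k) l := by
  induction l with
  | zero => rfl
  | succ l ih =>
    rw [← add_assoc]
    simp only [charAfterClaims, ih, add_assoc]

theorem charAfterClaims_fst_le (hw : 0 < C.waiting) {n : ℕ} {t : ℝ≥0} {z : State}
    (hz : 0 ≤ z.dur) (k : ℕ) (hτ : ∀ j < k, (C.afterClaims τ y β n t z j).1 ≤ τ (n + j)) :
    (C.charAfterClaims τ y β n (C.characteristic t z) k).1 ≤
      (C.afterClaims τ y β n t z k).1 + C.waiting := by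
  induction k with
  | zero =>
    have := neg_waiting_le_clockCoord hw hz
    simp only [charAfterClaims, afterClaims, characteristic]
    linarith
  | succ k ih =>
    have hle : ((C.afterClaims τ y β n t z k).1 : ℝ) ≤ τ (n + k) := mod_cast hτ k k.lt_succ_self
    exact charClaim_fst_le ((ih fun j hj => hτ j (hj.trans k.lt_succ_self)).trans (by gcongr)) _ _

end Claims

/-! ### Bounded drift -/

variable (C) in
/-- The drift is measurable and, at nonnegative clocks, bounded by `c` in absolute value. -/
structure HasBoundedDrift (c : ℝ≥0) : Prop where
  measurable_drift : ∀ i, Measurable (C.drift i)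
  abs_drift_le : ∀ i s, 0 ≤ s → |C.drift i s| ≤ c

theorem hasBoundedDrift_income (hmeas : ∀ i, Measurable fun s => C.premium i s (C.deductible i))
    (hnonneg : ∀ i s, 0 ≤ s → 0 ≤ C.premium i s (C.deductible i))
    (hincome : ∀ i s, 0 ≤ s → C.premium i s (C.deductible i) < C.income) :
    C.HasBoundedDrift C.income.toNNReal where
  measurable_drift i := (hmeas i).const_sub C.income
  abs_drift_le i s hs := by
    have h0 := hnonneg i s hs
    have h1 := hincome i s hs
    rw [drift, Real.coe_toNNReal _ (h0.trans h1.le), abs_le]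
    constructor <;> linarith

namespace HasBoundedDrift

variable {c : ℝ≥0}

theorem measurable_lineDrift (hC : C.HasBoundedDrift c) : Measurable C.lineDrift := by
  have heq : C.lineDrift = fun σ => if σ < 0 then C.drift .C2 (max 0 (σ + C.waiting))
      else C.drift .C1 (max 0 σ) := by
    funext σ
    unfold lineDrift lineClass lineClock
    split_ifs <;> rfl
  have h1 := hC.measurable_drift .C1
  have h2 := hC.measurable_drift .C2
  rw [heq]
  exact Measurable.ite measurableSet_Iio (by fun_prop) (by fun_prop)

theorem abs_lineDrift_le (hC : C.HasBoundedDrift c) (σ : ℝ) : |C.lineDrift σ| ≤ c :=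
  hC.abs_drift_le _ _ (le_max_left _ _)

theorem intervalIntegrable_lineDrift (hC : C.HasBoundedDrift c) (a b : ℝ) :
    IntervalIntegrable C.lineDrift volume a b :=
  IntervalIntegrable.mono_fun' (f := C.lineDrift) (g := fun _ => c) intervalIntegrable_const
    hC.measurable_lineDrift.aestronglyMeasurable (Filter.Eventually.of_forall hC.abs_lineDrift_le)

theorem lineGain_sub (hC : C.HasBoundedDrift c) (a b : ℝ) :
    C.lineGain b - C.lineGain a = ∫ v in a..b, C.lineDrift v :=
  intervalIntegral.integral_interval_sub_left (hC.intervalIntegrable_lineDrift 0 b)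
    (hC.intervalIntegrable_lineDrift 0 a)

theorem lipschitzWith_lineGain (hC : C.HasBoundedDrift c) : LipschitzWith c C.lineGain :=
  LipschitzWith.of_dist_le_mul fun a b => by
    rw [Real.dist_eq, hC.lineGain_sub]
    exact intervalIntegral.norm_integral_le_of_norm_le_const (f := C.lineDrift) fun v _ =>
      hC.abs_lineDrift_le v

theorem abs_lineGain_sub_le (hC : C.HasBoundedDrift c) (a b : ℝ) :
    |C.lineGain a - C.lineGain b| ≤ c * |a - b| :=
  hC.lipschitzWith_lineGain.dist_le_mul a b

theorem integral_drift_C1 (hC : C.HasBoundedDrift c) {a b : ℝ} (ha : 0 ≤ a) (hab : a ≤ b) :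
    ∫ v in a..b, C.drift .C1 v = C.lineGain b - C.lineGain a := by
  rw [hC.lineGain_sub]
  refine intervalIntegral.integral_congr_Ioo_of_le hab fun v hv => ?_
  have hv0 : 0 ≤ v := ha.trans hv.1.le
  simp only [lineDrift, lineClass_of_nonneg hv0, lineClock_of_nonneg hv0, max_eq_right hv0]

theorem integral_drift_C2 (hC : C.HasBoundedDrift c) {a b : ℝ} (ha : 0 ≤ a) (hab : a ≤ b)
    (hb : b ≤ C.waiting) :
    ∫ v in a..b, C.drift .C2 v = C.lineGain (b - C.waiting) - C.lineGain (a - C.waiting) := by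
  rw [hC.lineGain_sub, ← intervalIntegral.integral_comp_sub_right]
  refine intervalIntegral.integral_congr_Ioo_of_le hab fun v hv => ?_
  have hneg : v - C.waiting < 0 := sub_neg.2 (hv.2.trans_le hb)
  simp only [lineDrift, lineClass_of_neg hneg, lineClock_of_neg hneg, sub_add_cancel,
    max_eq_right (ha.trans hv.1.le)]

theorem flow_eq_stateAt (hC : C.HasBoundedDrift c) {z : State} (hz : 0 ≤ z.dur)
    (hz2 : z.cls = .C2 → z.dur ≤ C.waiting) (t : ℝ) {d : ℝ} (hd : 0 ≤ d) :
    C.flow d z = C.stateAt (C.characteristic t z) (t + d) := by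
  rcases z with ⟨_ | _, s, x⟩
  · have hσ : t + d - (t - s) = s + d := by ring
    have hpos : 0 ≤ s + d := add_nonneg hz hd
    simp only [flow, stateAt, characteristic, clockCoord, hσ, lineClass_of_nonneg hpos,
      lineClock_of_nonneg hpos, hC.integral_drift_C1 hz (le_add_of_nonneg_right hd)]
    congr 1
    ring
  · have hσ : t + d - (t - (s - C.waiting)) = s + d - C.waiting := by ring
    simp only [flow, stateAt, characteristic, clockCoord, hσ]
    split_ifs with hlt
    · rw [lineClass_of_neg (sub_neg.2 hlt), lineClock_of_neg (sub_neg.2 hlt),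
        hC.integral_drift_C2 hz (le_add_of_nonneg_right hd) hlt.le]
      congr 1 <;> ring
    · have hpos : 0 ≤ s + d - C.waiting := sub_nonneg.2 (not_lt.1 hlt)
      rw [lineClass_of_nonneg hpos, lineClock_of_nonneg hpos,
        hC.integral_drift_C2 hz (hz2 rfl) le_rfl, hC.integral_drift_C1 le_rfl hpos, sub_self]
      congr 1
      ring

theorem flow_stateAt (hC : C.HasBoundedDrift c) {q : ℝ × ℝ} {u d : ℝ}
    (hq : q.1 ≤ u + C.waiting) (hd : 0 ≤ d) :
    C.flow d (C.stateAt q u) = C.stateAt q (u + d) := by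
  have hdur : 0 ≤ C.lineClock (u - q.1) ∧
      (lineClass (u - q.1) = .C2 → C.lineClock (u - q.1) ≤ C.waiting) := by
    rcases lt_or_ge (u - q.1) 0 with hσ | hσ
    · rw [lineClock_of_neg hσ]
      exact ⟨by linarith, fun _ => by linarith⟩
    · rw [lineClock_of_nonneg hσ, lineClass_of_nonneg hσ]
      exact ⟨hσ, fun h => InsClass.noConfusion h⟩
  rw [hC.flow_eq_stateAt hdur.1 hdur.2 u hd, characteristic_stateAt]

theorem flow_afterClaims (hC : C.HasBoundedDrift c) (hw : 0 < C.waiting) {τ : ℕ → ℝ≥0}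
    {y : ℕ → ℝ} {β : ℝ≥0 → ℝ≥0} {n : ℕ} {t : ℝ≥0} {z : State} (hz : 0 ≤ z.dur)
    (hz2 : z.cls = .C2 → z.dur ≤ C.waiting) (k : ℕ)
    (hτ : ∀ j < k, (C.afterClaims τ y β n t z j).1 ≤ τ (n + j)) {u : ℝ}
    (hu : (C.afterClaims τ y β n t z k).1 ≤ u) :
    C.flow (u - (C.afterClaims τ y β n t z k).1) (C.afterClaims τ y β n t z k).2 =
      C.stateAt (C.charAfterClaims τ y β n (C.characteristic t z) k) u := by
  induction k generalizing u with
  | zero =>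
    simp only [afterClaims, charAfterClaims] at hu ⊢
    rw [hC.flow_eq_stateAt hz hz2 t (sub_nonneg.2 hu), add_sub_cancel]
  | succ k ih =>
    have hstate : (C.afterClaims τ y β n t z (k + 1)).2 =
        C.stateAt (C.charAfterClaims τ y β n (C.characteristic t z) (k + 1))
          (C.afterClaims τ y β n t z (k + 1)).1 := by
      simp only [afterClaims, charAfterClaims]
      rw [ih (fun j hj => hτ j (hj.trans k.lt_succ_self)) (mod_cast hτ k k.lt_succ_self),
        claim_stateAt hw]
    rw [hstate, hC.flow_stateAt (charAfterClaims_fst_le hw hz (k + 1) hτ) (sub_nonneg.2 hu),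
      add_sub_cancel]

end HasBoundedDrift

/-! ### Pathwise estimates -/

variable (C) in
/-- A common bound for the deductibles and for their differences. -/
noncomputable def deductibleBound : ℝ≥0 := ‖C.deductible .C1‖₊ + ‖C.deductible .C2‖₊

theorem abs_deductible_le (i : InsClass) : |C.deductible i| ≤ C.deductibleBound := by
  cases i <;> simp [deductibleBound]

theorem abs_deductible_sub_le (i j : InsClass) :
    |C.deductible i - C.deductible j| ≤ C.deductibleBound := by
  rcases i with _ | _ <;> rcases j with _ | _
  · simp
  · exact norm_sub_le (C.deductible .C1) (C.deductible .C2)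
  · exact (norm_sub_le (C.deductible .C2) (C.deductible .C1)).trans_eq (add_comm _ _)
  · simp

/-- A distance of characteristics that bounds the distance of the wealths at any common time when
the drift is bounded by `c`. -/
def charDist (c : ℝ≥0) (q q' : ℝ × ℝ) : ℝ := |q.2 - q'.2| + c * |q.1 - q'.1|

section ClaimSequence

variable {c : ℝ≥0} {τ : ℕ → ℝ≥0} {y : ℕ → ℝ} {β : ℝ≥0 → ℝ≥0} {n : ℕ}

theorem abs_wealth_stateAt_sub_le (hC : C.HasBoundedDrift c) (q q' : ℝ × ℝ) (u : ℝ) :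
    |(C.stateAt q u).wealth - (C.stateAt q' u).wealth| ≤ charDist c q q' :=
  calc |(C.stateAt q u).wealth - (C.stateAt q' u).wealth|
      = |(q.2 - q'.2) + (C.lineGain (u - q.1) - C.lineGain (u - q'.1))| := by
        simp only [stateAt]
        congr 1
        ring
    _ ≤ |q.2 - q'.2| + c * |(u - q.1) - (u - q'.1)| :=
        (abs_add_le _ _).trans (by gcongr; exact hC.abs_lineGain_sub_le _ _)
    _ = charDist c q q' := by rw [charDist, sub_sub_sub_cancel_left, abs_sub_comm q'.1]

theorem abs_charClaim_snd_sub_le_of_lt (hC : C.HasBoundedDrift c) {r x β : ℝ} (h : β < x)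
    (q q' : ℝ × ℝ) :
    |(C.charClaim r x β q).2 - (C.charClaim r x β q').2| ≤ charDist c q q' +
      |C.deductible (lineClass (r - q.1)) - C.deductible (lineClass (r - q'.1))| := by
  have hmin : |min x (C.deductible (lineClass (r - q.1)))
      - min x (C.deductible (lineClass (r - q'.1)))| ≤
      |C.deductible (lineClass (r - q.1)) - C.deductible (lineClass (r - q'.1))| := by
    simpa using abs_min_sub_min_le_max x (C.deductible (lineClass (r - q.1))) x
      (C.deductible (lineClass (r - q'.1)))
  calc |(C.charClaim r x β q).2 - (C.charClaim r x β q').2|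
      = |((C.stateAt q r).wealth - (C.stateAt q' r).wealth)
          - (min x (C.deductible (lineClass (r - q.1)))
            - min x (C.deductible (lineClass (r - q'.1))))| := by
        simp only [charClaim_of_lt h, stateAt]
        congr 1
        ring
    _ ≤ _ := (abs_sub _ _).trans (add_le_add (abs_wealth_stateAt_sub_le hC q q' r) hmin)

/-- Until the first reported claim the two policyholders lose the same amounts; that claim puts
them on the same clock forever. -/
theorem charAfterClaims_unmerged_or_merged (hC : C.HasBoundedDrift c) {δ : ℝ}
    (q q' : ℝ × ℝ) (k : ℕ)
    (hδ : ∀ j < k, |C.deductible (lineClass (τ (n + j) - q.1))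
      - C.deductible (lineClass (τ (n + j) - q'.1))| ≤ δ) :
    ((C.charAfterClaims τ y β n q k).1 = q.1 ∧ (C.charAfterClaims τ y β n q' k).1 = q'.1 ∧
      (C.charAfterClaims τ y β n q k).2 - (C.charAfterClaims τ y β n q' k).2 = q.2 - q'.2) ∨
    ((C.charAfterClaims τ y β n q k).1 = (C.charAfterClaims τ y β n q' k).1 ∧
      |(C.charAfterClaims τ y β n q k).2 - (C.charAfterClaims τ y β n q' k).2| ≤
        charDist c q q' + δ) := by
  induction k with
  | zero => exact .inl ⟨rfl, rfl, rfl⟩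
  | succ k ih =>
    specialize ih fun j hj => hδ j (hj.trans k.lt_succ_self)
    simp only [charAfterClaims]
    generalize C.charAfterClaims τ y β n q k = p at ih ⊢
    generalize C.charAfterClaims τ y β n q' k = p' at ih ⊢
    rcases le_or_gt (y (n + k)) (β (τ (n + k))) with hreport | hreport
    · simpa only [charClaim_of_le hreport, sub_sub_sub_cancel_right] using ih
    · refine .inr ⟨by simp only [charClaim_of_lt hreport],
        (abs_charClaim_snd_sub_le_of_lt hC hreport p p').trans ?_⟩
      rcases ih with ⟨hp, hp', hsub⟩ | ⟨hp, hsub⟩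
      · rw [charDist, hp, hp', hsub]
        exact add_le_add_right (hδ k k.lt_succ_self) _
      · simpa [charDist, hp] using hsub

theorem charDist_charAfterClaims_le (hC : C.HasBoundedDrift c) {δ : ℝ} (hδ0 : 0 ≤ δ)
    (q q' : ℝ × ℝ) (k : ℕ)
    (hδ : ∀ j < k, |C.deductible (lineClass (τ (n + j) - q.1))
      - C.deductible (lineClass (τ (n + j) - q'.1))| ≤ δ) :
    charDist c (C.charAfterClaims τ y β n q k) (C.charAfterClaims τ y β n q' k) ≤
      charDist c q q' + δ := by
  rcases charAfterClaims_unmerged_or_merged hC q q' k hδ with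
    ⟨hp, hp', hsub⟩ | ⟨hp, hsub⟩
  · rw [charDist, hp, hp', hsub]
    exact le_add_of_nonneg_right hδ0
  · simpa [charDist, hp] using hsub

theorem charClaim_fst_mem_Icc (hw : 0 < C.waiting) {T r : ℝ} (hr : r ∈ Icc 0 T) (x β : ℝ)
    {q : ℝ × ℝ} (hq : q.1 ∈ Icc 0 (T + C.waiting)) :
    (C.charClaim r x β q).1 ∈ Icc 0 (T + C.waiting) := by
  rcases le_or_gt x β with h | h
  · rwa [charClaim_of_le h]
  · rw [charClaim_of_lt h]
    exact ⟨by linarith [hr.1], by linarith [hr.2]⟩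

theorem charDist_charClaim_le (hC : C.HasBoundedDrift c) (hw : 0 < C.waiting) {T r : ℝ}
    (hr : r ∈ Icc 0 T) (x β : ℝ) {q : ℝ × ℝ} (hq : q.1 ∈ Icc 0 (T + C.waiting)) :
    charDist c (C.charClaim r x β q) q ≤
      |x| + (2 * (c * (T + C.waiting)) + C.deductibleBound) := by
  have hpos : 0 ≤ c * (T + C.waiting) := mul_nonneg c.2 (hq.1.trans hq.2)
  rcases le_or_gt x β with h | h
  · rw [charClaim_of_le h]
    simp only [charDist, sub_sub_cancel_left, abs_neg, sub_self, abs_zero, mul_zero]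
    linarith [C.deductibleBound.coe_nonneg]
  · have hclock : c * |r + C.waiting - q.1| ≤ c * (T + C.waiting) := by
      gcongr
      rw [abs_le]
      constructor <;> linarith [hr.1, hr.2, hq.1, hq.2]
    have hgain : |C.lineGain (r - q.1) - C.lineGain (-C.waiting)| ≤ c * (T + C.waiting) := by
      refine (hC.abs_lineGain_sub_le _ _).trans (le_of_eq_of_le ?_ hclock)
      congr 2
      ring
    have hmin : |min x (C.deductible (lineClass (r - q.1)))| ≤ |x| + C.deductibleBound :=
      abs_min_le_max_abs_abs.trans (max_le (le_add_of_nonneg_right C.deductibleBound.2)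
        ((abs_deductible_le _).trans (le_add_of_nonneg_left (abs_nonneg x))))
    have hwealth : |q.2 + C.lineGain (r - q.1) - C.lineGain (-C.waiting)
        - min x (C.deductible (lineClass (r - q.1))) - q.2| ≤
        c * (T + C.waiting) + (|x| + C.deductibleBound) := by
      refine le_of_eq_of_le ?_ ((abs_sub _ _).trans (add_le_add hgain hmin))
      congr 1
      ring
    rw [charClaim_of_lt h, charDist]
    linarith

theorem charAfterClaims_fst_mem_Icc (hw : 0 < C.waiting) {T : ℝ} {q : ℝ × ℝ}
    (hq : q.1 ∈ Icc 0 (T + C.waiting)) (k : ℕ) (hτ : ∀ j < k, (τ (n + j) : ℝ) ∈ Icc 0 T) :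
    (C.charAfterClaims τ y β n q k).1 ∈ Icc 0 (T + C.waiting) := by
  induction k with
  | zero => exact hq
  | succ k ih =>
    exact charClaim_fst_mem_Icc hw (hτ k k.lt_succ_self) _ _
      (ih fun j hj => hτ j (hj.trans k.lt_succ_self))

variable (C) in
/-- A bound for the change of the final wealth, beyond the size of the claim, that is caused by
leaving out one claim up to time `T`. -/
noncomputable def claimEffect (c : ℝ≥0) (T : ℝ) : ℝ :=
  2 * (c * (T + C.waiting)) + 2 * C.deductibleBound

/-- Leaving out the first `k` claims one after the other, each omission moves the characteristic,
and the two resulting policyholders then face the same claims. -/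
theorem abs_wealth_charAfterClaims_add_sub_le (hC : C.HasBoundedDrift c) (hw : 0 < C.waiting)
    {T : ℝ} {q : ℝ × ℝ} (hq : q.1 ∈ Icc 0 (T + C.waiting)) (k l : ℕ)
    (hτ : ∀ j < k, (τ (n + j) : ℝ) ∈ Icc 0 T) :
    |(C.stateAt (C.charAfterClaims τ y β n q (k + l)) T).wealth
      - (C.stateAt (C.charAfterClaims τ y β (n + k) q l) T).wealth| ≤
      ∑ j ∈ Finset.range k, (|y (n + j)| + C.claimEffect c T) := by
  let W : ℕ → ℝ := fun j =>
    (C.stateAt (C.charAfterClaims τ y β (n + k) (C.charAfterClaims τ y β n q j) l) T).wealth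
  have hstep : ∀ {j}, j < k → dist (W j) (W (j + 1)) ≤ |y (n + j)| + C.claimEffect c T := by
    intro j hj
    have hmem : (C.charAfterClaims τ y β n q j).1 ∈ Icc 0 (T + C.waiting) :=
      charAfterClaims_fst_mem_Icc hw hq j fun i hi => hτ i (hi.trans hj)
    have hmove : charDist c (C.charAfterClaims τ y β n q (j + 1)) (C.charAfterClaims τ y β n q j)
        ≤ |y (n + j)| + (2 * (c * (T + C.waiting)) + C.deductibleBound) :=
      charDist_charClaim_le hC hw (hτ j hj) _ _ hmem
    calc dist (W j) (W (j + 1)) = |W (j + 1) - W j| := dist_comm _ _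
      _ ≤ charDist c (C.charAfterClaims τ y β n q (j + 1)) (C.charAfterClaims τ y β n q j)
          + C.deductibleBound :=
        (abs_wealth_stateAt_sub_le hC _ _ T).trans (charDist_charAfterClaims_le hC
          C.deductibleBound.2 _ _ l fun _ _ => abs_deductible_sub_le _ _)
      _ ≤ |y (n + j)| + C.claimEffect c T := by
        rw [claimEffect]
        linarith
  rw [charAfterClaims_add, ← Real.dist_eq, dist_comm]
  exact dist_le_range_sum_of_dist_le k hstep

end ClaimSequence

end Contract

/-! ### Claim times and claim loads -/

section ClaimTimes

variable {Ω : Type*} {N : ℝ≥0 → Ω → ℕ} {j : ℕ} {u v : ℝ≥0} {ω : Ω}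

theorem claimTime_le (hj : j < N u ω) : claimTime N j ω ≤ u :=
  csInf_le (OrderBot.bddBelow _) hj

theorem le_claimTime (hmono : Monotone fun t => N t ω) (hu : N u ω ≤ j) (hv : j < N v ω) :
    u ≤ claimTime N j ω :=
  le_csInf ⟨v, hv⟩ fun _ ha => (hmono.reflect_lt (hu.trans_lt ha)).le

theorem lt_of_claimTime_lt (hmono : Monotone fun t => N t ω) (hv : j < N v ω)
    (hu : claimTime N j ω < u) : j < N u ω := by
  obtain ⟨a, ha, hau⟩ := exists_lt_of_csInf_lt ⟨v, hv⟩ hu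
  exact lt_of_lt_of_le ha (hmono hau.le)

theorem claimTime_mono {l : ℕ} (hjl : j ≤ l) (hl : l < N u ω) :
    claimTime N j ω ≤ claimTime N l ω :=
  csInf_le_csInf (OrderBot.bddBelow _) ⟨u, hl⟩ fun _ ha => lt_of_le_of_lt hjl ha

theorem claimTime_eq_zero (h : ∀ v, N v ω ≤ j) : claimTime N j ω = 0 := by
  have hempty : {v : ℝ≥0 | j < N v ω} = ∅ := eq_empty_of_forall_notMem fun v => (h v).not_gt
  rw [claimTime, hempty, NNReal.sInf_empty]

/-- The second alternative is about a claim that never occurs, where `claimTime` is `sInf ∅ = 0`. -/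
theorem claimTime_lt_iff (hmono : Monotone fun t => N t ω) :
    claimTime N j ω < u ↔
      (∃ a : ℚ, Real.toNNReal a < u ∧ j < N (Real.toNNReal a) ω) ∨
        (0 < u ∧ ∀ n : ℕ, N n ω ≤ j) := by
  constructor
  · intro h
    by_cases hne : ∃ v, j < N v ω
    · obtain ⟨v, hv⟩ := hne
      obtain ⟨a, -, ha, hau⟩ := (NNReal.lt_iff_exists_rat_btwn _ _).1 h
      exact .inl ⟨a, hau, lt_of_claimTime_lt hmono hv ha⟩
    · push Not at hne
      exact .inr ⟨pos_of_gt h, fun n => hne n⟩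
  · rintro (⟨a, hau, ha⟩ | ⟨hu, h⟩)
    · exact (claimTime_le ha).trans_lt hau
    · rwa [claimTime_eq_zero fun v =>
        let ⟨n, hn⟩ := exists_nat_ge v
        (hmono hn).trans (h n)]

/-- The total size of the claims in `(s, t]`, with an additional cost `a` for each of them. -/
def claimLoad (N : ℝ≥0 → Ω → ℕ) (Y : ℕ → Ω → ℝ) (a : ℝ) (s t : ℝ≥0) (ω : Ω) : ℝ :=
  ∑ j ∈ Finset.Ico (N s ω) (N t ω), (|Y j ω| + a)

theorem claimLoad_eq (N : ℝ≥0 → Ω → ℕ) (Y : ℕ → Ω → ℝ) (a : ℝ) (s t : ℝ≥0) :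
    claimLoad N Y a s t = fun ω => ∑ j ∈ Finset.Ico (N s ω) (N t ω), |Y j ω|
      + ((N t ω - N s ω : ℕ) : ℝ) * a := by
  funext ω
  simp [claimLoad, Finset.sum_add_distrib]

theorem measurable_claimTime [MeasurableSpace Ω] (hN : ∀ t, Measurable (N t))
    (hmono : ∀ ω, Monotone fun t => N t ω) (j : ℕ) : Measurable (claimTime N j) := by
  refine measurable_of_Iio fun u => ?_
  have hlt : ∀ v, MeasurableSet {ω | j < N v ω} := fun v => hN v measurableSet_Ioi
  have hle : ∀ v, MeasurableSet {ω | N v ω ≤ j} := fun v => hN v measurableSet_Iic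
  have heq : claimTime N j ⁻¹' Iio u =
      {ω | (∃ a : ℚ, Real.toNNReal a < u ∧ j < N (Real.toNNReal a) ω) ∨
        (0 < u ∧ ∀ n : ℕ, N n ω ≤ j)} := by
    ext ω
    exact claimTime_lt_iff (hmono ω)
  rw [heq]
  measurability

end ClaimTimes

/-! ### Expected numbers and sums of claims -/

section ClaimMeans

variable {Ω : Type*} [MeasurableSpace Ω] {P : Measure Ω}

theorem measurable_sum_Ico {M : Type*} [AddCommMonoid M] [MeasurableSpace M] [MeasurableAdd₂ M]
    {m n : Ω → ℕ} {f : ℕ → Ω → M} (hm : Measurable m) (hn : Measurable n)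
    (hf : ∀ j, Measurable (f j)) : Measurable fun ω => ∑ j ∈ Finset.Ico (m ω) (n ω), f j ω := by
  have h : Measurable fun p : Ω × ℕ × ℕ => ∑ j ∈ Finset.Ico p.2.1 p.2.2, f j p.1 :=
    measurable_from_prod_countable_left fun n =>
      Finset.measurable_fun_sum (Finset.Ico n.1 n.2) fun j _ => hf j
  exact h.comp (measurable_id.prodMk (hm.prodMk hn))

theorem integrable_of_lintegral_enorm_le {f : Ω → ℝ} (hf : Measurable f) {r : ℝ≥0}
    (h : ∫⁻ ω, ‖f ω‖ₑ ∂P ≤ r) : Integrable f P :=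
  ⟨hf.aestronglyMeasurable, h.trans_lt ENNReal.coe_lt_top⟩

theorem integral_le_of_lintegral_enorm_le {f : Ω → ℝ} (hf : Measurable f) {r : ℝ≥0}
    (h : ∫⁻ ω, ‖f ω‖ₑ ∂P ≤ r) : ∫ ω, f ω ∂P ≤ r :=
  calc ∫ ω, f ω ∂P ≤ ∫ ω, ‖f ω‖ ∂P := (le_abs_self _).trans (norm_integral_le_integral_norm f)
    _ = (∫⁻ ω, ‖f ω‖ₑ ∂P).toReal := integral_norm_eq_lintegral_enorm hf.aestronglyMeasurable
    _ ≤ r := ENNReal.toReal_le_coe_of_le_coe h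

/-- Claim arrivals `N` and claim sizes `Y` such that the mean number of claims and the mean total
size of the claims in a period are at most `ρ` and `σ` times its length. -/
structure HasLinearClaimMeans (N : ℝ≥0 → Ω → ℕ) (Y : ℕ → Ω → ℝ) (ρ σ : ℝ≥0) (P : Measure Ω) :
    Prop where
  measurable_count : ∀ t, Measurable (N t)
  mono : ∀ ω, Monotone fun t => N t ω
  measurable_size : ∀ j, Measurable (Y j)
  lintegral_count_sub_le : ∀ {s t : ℝ≥0}, s ≤ t →
    ∫⁻ ω, ((N t ω - N s ω : ℕ) : ENNReal) ∂P ≤ (ρ * (t - s) : ℝ≥0)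
  lintegral_sum_size_le : ∀ {s t : ℝ≥0}, s ≤ t →
    ∫⁻ ω, ∑ j ∈ Finset.Ico (N s ω) (N t ω), ‖Y j ω‖ₑ ∂P ≤ (σ * (t - s) : ℝ≥0)

namespace HasLinearClaimMeans

variable {N : ℝ≥0 → Ω → ℕ} {Y : ℕ → Ω → ℝ} {ρ σ : ℝ≥0} {s t : ℝ≥0}

theorem measurable_count_sub (hM : HasLinearClaimMeans N Y ρ σ P) (s t : ℝ≥0) :
    Measurable fun ω => ((N t ω - N s ω : ℕ) : ℝ) :=
  (measurable_from_top (f := (Nat.cast : ℕ → ℝ))).comp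
    ((hM.measurable_count t).sub (hM.measurable_count s))

theorem lintegral_enorm_count_sub_le (hM : HasLinearClaimMeans N Y ρ σ P) (hst : s ≤ t) :
    ∫⁻ ω, ‖((N t ω - N s ω : ℕ) : ℝ)‖ₑ ∂P ≤ (ρ * (t - s) : ℝ≥0) := by
  simpa using hM.lintegral_count_sub_le hst

theorem integrable_count_sub (hM : HasLinearClaimMeans N Y ρ σ P) (hst : s ≤ t) :
    Integrable (fun ω => ((N t ω - N s ω : ℕ) : ℝ)) P :=
  integrable_of_lintegral_enorm_le (hM.measurable_count_sub s t)
    (hM.lintegral_enorm_count_sub_le hst)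

theorem integral_count_sub_le (hM : HasLinearClaimMeans N Y ρ σ P) (hst : s ≤ t) :
    ∫ ω, ((N t ω - N s ω : ℕ) : ℝ) ∂P ≤ ρ * (t - s) :=
  (integral_le_of_lintegral_enorm_le (hM.measurable_count_sub s t)
    (hM.lintegral_enorm_count_sub_le hst)).trans_eq (by rw [NNReal.coe_mul, NNReal.coe_sub hst])

theorem measurable_sum_abs_size (hM : HasLinearClaimMeans N Y ρ σ P) (s t : ℝ≥0) :
    Measurable fun ω => ∑ j ∈ Finset.Ico (N s ω) (N t ω), |Y j ω| :=
  measurable_sum_Ico (hM.measurable_count s) (hM.measurable_count t) fun j =>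
    (hM.measurable_size j).abs

theorem lintegral_enorm_sum_abs_size_le (hM : HasLinearClaimMeans N Y ρ σ P) (hst : s ≤ t) :
    ∫⁻ ω, ‖∑ j ∈ Finset.Ico (N s ω) (N t ω), |Y j ω|‖ₑ ∂P ≤ (σ * (t - s) : ℝ≥0) :=
  (lintegral_mono fun ω => (enorm_sum_le _ _).trans_eq (by simp)).trans
    (hM.lintegral_sum_size_le hst)

theorem integrable_claimLoad (hM : HasLinearClaimMeans N Y ρ σ P) (a : ℝ) (hst : s ≤ t) :
    Integrable (claimLoad N Y a s t) P := by
  rw [claimLoad_eq]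
  exact (integrable_of_lintegral_enorm_le (hM.measurable_sum_abs_size s t)
    (hM.lintegral_enorm_sum_abs_size_le hst)).add ((hM.integrable_count_sub hst).mul_const a)

theorem integral_claimLoad_le (hM : HasLinearClaimMeans N Y ρ σ P) {a : ℝ} (ha : 0 ≤ a)
    (hst : s ≤ t) : ∫ ω, claimLoad N Y a s t ω ∂P ≤ (σ + ρ * a) * (t - s) := by
  have hsize := integral_le_of_lintegral_enorm_le (hM.measurable_sum_abs_size s t)
    (hM.lintegral_enorm_sum_abs_size_le hst)
  rw [NNReal.coe_mul, NNReal.coe_sub hst] at hsize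
  rw [claimLoad_eq, integral_add (integrable_of_lintegral_enorm_le
    (hM.measurable_sum_abs_size s t) (hM.lintegral_enorm_sum_abs_size_le hst))
    ((hM.integrable_count_sub hst).mul_const a), integral_mul_const]
  calc _ ≤ σ * ((t : ℝ) - s) + ρ * (t - s) * a := by
        gcongr
        exact hM.integral_count_sub_le hst
    _ = (σ + ρ * a) * (t - s) := by ring

end HasLinearClaimMeans

theorem lintegral_natCast_poissonMeasure (r : ℝ≥0) :
    ∫⁻ n, (n : ENNReal) ∂(poissonMeasure r) = r := by
  have hterm : ∀ n : ℕ, ((n + 1 : ℕ) : ENNReal) * poissonMeasure r {n + 1} =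
      r * poissonMeasure r {n} := by
    intro n
    rw [poissonMeasure_singleton, poissonMeasure_singleton, ← ENNReal.ofReal_natCast,
      ← ENNReal.ofReal_coe_nnreal, ← ENNReal.ofReal_mul (by positivity),
      ← ENNReal.ofReal_mul (by positivity)]
    congr 1
    rw [Nat.factorial_succ]
    push_cast
    field_simp
    ring
  have hmass : ∑' n, poissonMeasure r {n} = 1 := by
    simpa using (lintegral_countable' (μ := poissonMeasure r) fun _ => 1).symm
  rw [lintegral_countable', tsum_eq_zero_add' ENNReal.summable]
  simp_rw [hterm]
  rw [ENNReal.tsum_mul_left, hmass]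
  simp

theorem lintegral_sum_Ico_eq_mul {m n : Ω → ℕ} {f : ℕ → Ω → ENNReal} {r : ENNReal}
    (hm : Measurable m) (hn : Measurable n) (hf : ∀ j, Measurable (f j))
    (hind : ∀ j, IndepFun (fun ω => (m ω, n ω)) (f j) P) (hr : ∀ j, ∫⁻ ω, f j ω ∂P = r) :
    ∫⁻ ω, ∑ j ∈ Finset.Ico (m ω) (n ω), f j ω ∂P = (∫⁻ ω, ((n ω - m ω : ℕ) : ENNReal) ∂P) * r := by
  let g : ℕ → ℕ × ℕ → ENNReal := fun j p => if j ∈ Finset.Ico p.1 p.2 then 1 else 0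
  have hgm : ∀ j, Measurable (g j) := fun j => measurable_of_countable _
  have hg : ∀ j, Measurable fun ω => g j (m ω, n ω) := fun j => (hgm j).comp (hm.prodMk hn)
  have hsum : ∀ (φ : ℕ → ENNReal) (p : ℕ × ℕ),
      ∑ j ∈ Finset.Ico p.1 p.2, φ j = ∑' j, g j p * φ j := by
    intro φ p
    rw [tsum_eq_sum (s := Finset.Ico p.1 p.2) fun j hj => by
      rw [show g j p = 0 from if_neg hj, zero_mul]]
    exact Finset.sum_congr rfl fun j hj => by rw [show g j p = 1 from if_pos hj, one_mul]
  calc ∫⁻ ω, ∑ j ∈ Finset.Ico (m ω) (n ω), f j ω ∂P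
      = ∑' j, ∫⁻ ω, g j (m ω, n ω) * f j ω ∂P := by
        rw [lintegral_congr fun ω => hsum (fun j => f j ω) (m ω, n ω)]
        exact lintegral_tsum fun j => ((hg j).mul (hf j)).aemeasurable
    _ = ∑' j, (∫⁻ ω, g j (m ω, n ω) ∂P) * r := tsum_congr fun j => by
        rw [← hr j]
        exact lintegral_mul_eq_lintegral_mul_lintegral_of_indepFun'' (hg j).aemeasurable
          (hf j).aemeasurable ((hind j).comp (hgm j) measurable_id)
    _ = (∫⁻ ω, ∑' j, g j (m ω, n ω) ∂P) * r := by
        rw [ENNReal.tsum_mul_right, lintegral_tsum fun j => (hg j).aemeasurable]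
    _ = (∫⁻ ω, ((n ω - m ω : ℕ) : ENNReal) ∂P) * r := by
        congr 1
        exact lintegral_congr fun ω => by simpa using (hsum (fun _ => 1) (m ω, n ω)).symm

variable {N : ℝ≥0 → Ω → ℕ} {Y : ℕ → Ω → ℝ} {rate : ℝ≥0}

theorem IsPoissonProcess.lintegral_sub (hN : IsPoissonProcess N rate P) {s t : ℝ≥0}
    (hst : s ≤ t) :
    ∫⁻ ω, ((N t ω - N s ω : ℕ) : ENNReal) ∂P = (rate * (t - s) : ℝ≥0) := by
  have hsub : Measurable fun ω => N t ω - N s ω := (hN.measurable t).sub (hN.measurable s)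
  rw [← lintegral_natCast_poissonMeasure, ← hN.law s t hst, lintegral_map measurable_from_top hsub]

namespace IsClaimModel

theorem lintegral_enorm_size_ne_top [IsFiniteMeasure P] (hM : IsClaimModel N Y rate P) :
    ∫⁻ ω, ‖Y 0 ω‖ₑ ∂P ≠ ⊤ :=
  (((memLp_two_iff_integrable_sq (hM.measurable_size 0).aestronglyMeasurable).2
    hM.secondMoment).integrable one_le_two).2.ne

theorem lintegral_sum_enorm_size (hM : IsClaimModel N Y rate P) {s t : ℝ≥0} (hst : s ≤ t) :
    ∫⁻ ω, ∑ j ∈ Finset.Ico (N s ω) (N t ω), ‖Y j ω‖ₑ ∂P =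
      (rate * (t - s) : ℝ≥0) * ∫⁻ ω, ‖Y 0 ω‖ₑ ∂P := by
  rw [← hM.poisson.lintegral_sub hst]
  refine lintegral_sum_Ico_eq_mul (hM.poisson.measurable s) (hM.poisson.measurable t)
    (fun j => (hM.measurable_size j).enorm) (fun j => ?_)
    fun j => ((hM.identDistrib_size j).comp measurable_enorm).lintegral_eq
  exact (hM.indep.comp (φ := fun y : ℕ → ℝ => ‖y j‖ₑ) (ψ := fun n : ℝ≥0 → ℕ => (n s, n t))
    (measurable_pi_apply j).enorm ((measurable_pi_apply s).prodMk (measurable_pi_apply t))).symm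

theorem hasLinearClaimMeans [IsFiniteMeasure P] (hM : IsClaimModel N Y rate P) :
    HasLinearClaimMeans N Y rate (rate * (∫⁻ ω, ‖Y 0 ω‖ₑ ∂P).toNNReal) P where
  measurable_count := hM.poisson.measurable
  mono := hM.poisson.mono
  measurable_size := hM.measurable_size
  lintegral_count_sub_le hst := (hM.poisson.lintegral_sub hst).le
  lintegral_sum_size_le hst := by
    rw [hM.lintegral_sum_enorm_size hst, mul_right_comm, ENNReal.coe_mul _ (ENNReal.toNNReal _),
      ENNReal.coe_toNNReal hM.lintegral_enorm_size_ne_top]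

end IsClaimModel

theorem zero_mem_barrierStrategies (hM : IsClaimModel N Y rate P) :
    (fun _ _ => 0) ∈ barrierStrategies hM :=
  stronglyMeasurable_const

theorem measurable_uncurry_of_mem_barrierStrategies {hM : IsClaimModel N Y rate P}
    {b : ℝ≥0 → Ω → ℝ≥0} (hb : b ∈ barrierStrategies hM) :
    Measurable (Function.uncurry b) := by
  have hle : (claimFiltration hM).predictable ≤ Prod.instMeasurableSpace :=
    measurableSpace_le_predictable_of_measurableSet
      (fun A hA => (measurableSet_singleton _).prod ((claimFiltration hM).le _ A hA))
      (fun i A hA => measurableSet_Ioi.prod ((claimFiltration hM).le _ A hA))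
  exact (StronglyMeasurable.mono hb hle).measurable

end ClaimMeans

/-! ### Terminal wealth -/

namespace Contract

section TerminalWealth

variable {C : Contract} {Ω : Type*} {N : ℝ≥0 → Ω → ℕ} {Y : ℕ → Ω → ℝ} {b : ℝ≥0 → Ω → ℝ≥0}
  {c T t t' : ℝ≥0} {q q' : ℝ × ℝ} {ω : Ω} {i : InsClass}

variable (C) in
/-- The wealth at time `T` of a policyholder whose characteristic at time `t` is `q`. -/
noncomputable def charWealth (N : ℝ≥0 → Ω → ℕ) (Y : ℕ → Ω → ℝ) (b : ℝ≥0 → Ω → ℝ≥0) (T t : ℝ≥0)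
    (q : ℝ × ℝ) (ω : Ω) : ℝ :=
  (C.stateAt (C.charAfterClaims (fun j => claimTime N j ω) (fun j => Y j ω) (fun v => b v ω)
    (N t ω) q (N T ω - N t ω)) T).wealth

theorem charWealth_self : C.charWealth N Y b T T q ω = (C.stateAt q T).wealth := by
  rw [charWealth, Nat.sub_self]
  rfl

theorem terminalWealth_eq_charWealth [MeasurableSpace Ω] (hC : C.HasBoundedDrift c)
    (hw : 0 < C.waiting) (hmono : ∀ ω, Monotone fun t => N t ω) {p : ℝ≥0 × ℝ × ℝ}
    (hp : p ∈ C.domain T i) :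
    C.terminalWealth N Y T i p.1 p.2.1 p.2.2 b =
      C.charWealth N Y b T p.1 (C.characteristic p.1 ⟨i, p.2.1, p.2.2⟩) := by
  obtain ⟨hs, -, hT, hs2⟩ := hp
  funext ω
  let time : ℕ → ℝ≥0 := fun k => (C.afterClaims (fun j => claimTime N j ω) (fun j => Y j ω)
    (fun v => b v ω) (N p.1 ω) p.1 ⟨i, p.2.1, p.2.2⟩ k).1
  have htime : ∀ j < N T ω - N p.1 ω, time j ≤ claimTime N (N p.1 ω + j) ω := by
    rintro (_ | j) hj
    · exact le_claimTime (hmono ω) le_rfl (Nat.lt_of_sub_pos hj)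
    · exact claimTime_mono (by omega) (show N p.1 ω + (j + 1) < N T ω by omega)
  have hlast : ∀ k ≤ N T ω - N p.1 ω, time k ≤ T := by
    rintro (_ | k) hk
    · exact hT
    · exact claimTime_le (by omega)
  exact congrArg State.wealth
    (hC.flow_afterClaims hw hs hs2 _ htime (NNReal.coe_le_coe.2 (hlast _ le_rfl)))

theorem characteristic_fst_mem_Icc (hw : 0 < C.waiting) {p : ℝ≥0 × ℝ × ℝ}
    (hp : p ∈ C.domain T i) :
    (C.characteristic p.1 ⟨i, p.2.1, p.2.2⟩).1 ∈ Icc (0 : ℝ) (T + C.waiting) := by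
  obtain ⟨hs, hst, hT, -⟩ := hp
  have : (p.1 : ℝ) ≤ T := hT
  cases i <;> simp only [characteristic, clockCoord, mem_Icc] <;> constructor <;> linarith

theorem abs_characteristic_fst_sub_le (p p' : ℝ≥0 × ℝ × ℝ) :
    |(C.characteristic p.1 ⟨i, p.2.1, p.2.2⟩).1 - (C.characteristic p'.1 ⟨i, p'.2.1, p'.2.2⟩).1| ≤
      2 * dist p p' := by
  have ht : |(p.1 : ℝ) - p'.1| ≤ dist p p' := le_max_left _ _
  have hs : |p.2.1 - p'.2.1| ≤ dist p p' := (le_max_left _ _).trans (le_max_right _ _)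
  calc _ = |((p.1 : ℝ) - p'.1) - (p.2.1 - p'.2.1)| := by
        congr 1
        cases i <;> simp only [characteristic, clockCoord] <;> ring
    _ ≤ 2 * dist p p' := (abs_sub _ _).trans (by linarith)

theorem charDist_characteristic_le (hC : C.HasBoundedDrift c) (p p' : ℝ≥0 × ℝ × ℝ) :
    charDist c (C.characteristic p.1 ⟨i, p.2.1, p.2.2⟩)
      (C.characteristic p'.1 ⟨i, p'.2.1, p'.2.2⟩) ≤ (1 + 3 * c) * dist p p' := by
  have hs : |p.2.1 - p'.2.1| ≤ dist p p' := (le_max_left _ _).trans (le_max_right _ _)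
  have hx : |p.2.2 - p'.2.2| ≤ dist p p' := (le_max_right _ _).trans (le_max_right _ _)
  have hgain : |C.lineGain (C.clockCoord i p.2.1) - C.lineGain (C.clockCoord i p'.2.1)| ≤
      c * dist p p' := by
    refine (hC.abs_lineGain_sub_le _ _).trans ?_
    gcongr
    cases i <;> simpa [clockCoord] using hs
  have hwealth : |(C.characteristic p.1 ⟨i, p.2.1, p.2.2⟩).2
      - (C.characteristic p'.1 ⟨i, p'.2.1, p'.2.2⟩).2| ≤ dist p p' + c * dist p p' := by
    refine le_of_eq_of_le ?_ ((abs_sub _ _).trans (add_le_add hx hgain))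
    simp only [characteristic]
    congr 1
    ring
  calc _ ≤ (dist p p' + c * dist p p') + c * (2 * dist p p') :=
        add_le_add hwealth (mul_le_mul_of_nonneg_left (abs_characteristic_fst_sub_le p p') c.2)
    _ = (1 + 3 * c) * dist p p' := by ring

theorem abs_charWealth_time_sub_le (hC : C.HasBoundedDrift c) (hw : 0 < C.waiting)
    (hmono : Monotone fun t => N t ω) (htt' : t ≤ t') (ht' : t' ≤ T)
    (hq : q.1 ∈ Icc (0 : ℝ) (T + C.waiting)) :
    |C.charWealth N Y b T t q ω - C.charWealth N Y b T t' q ω| ≤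
      claimLoad N Y (C.claimEffect c T) t t' ω := by
  have hle : N t ω ≤ N t' ω := hmono htt'
  have hle' : N t' ω ≤ N T ω := hmono ht'
  have hclaims := abs_wealth_charAfterClaims_add_sub_le (τ := fun j => claimTime N j ω)
    (y := fun j => Y j ω) (β := fun v => b v ω) (n := N t ω) hC hw hq (N t' ω - N t ω)
    (N T ω - N t' ω) fun j hj =>
      ⟨NNReal.coe_nonneg _, NNReal.coe_le_coe.2 (claimTime_le (by omega))⟩
  rwa [add_comm (N t' ω - N t ω), tsub_add_tsub_cancel hle' hle, add_tsub_cancel_of_le hle,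
    ← Finset.sum_Ico_eq_sum_range (fun j => |Y j ω| + C.claimEffect c T)] at hclaims

/-- The number of claims in an interval that contains all times from `θ ⊓ θ'`, inclusive, to
`θ ⊔ θ'`. It is extended to the left because `N v - N u` does not count a claim at time `u`. -/
noncomputable def crossingCount (N : ℝ≥0 → Ω → ℕ) (θ θ' : ℝ) (ω : Ω) : ℕ :=
  N (max θ θ').toNNReal ω - N (min θ θ' - |θ - θ'|).toNNReal ω

theorem one_le_crossingCount (hmono : Monotone fun t => N t ω) {j : ℕ} (h0 : N 0 ω ≤ j)
    (hj : j < N T ω) {θ θ' : ℝ}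
    (hne : lineClass (claimTime N j ω - θ) ≠ lineClass (claimTime N j ω - θ')) :
    1 ≤ crossingCount N θ θ' ω := by
  have hcross : (claimTime N j ω : ℝ) < max θ θ' ∧ min θ θ' - |θ - θ'| < claimTime N j ω := by
    rcases lt_or_ge ((claimTime N j ω : ℝ) - θ) 0 with h | h <;>
    rcases lt_or_ge ((claimTime N j ω : ℝ) - θ') 0 with h' | h'
    · exact absurd ((lineClass_of_neg h).trans (lineClass_of_neg h').symm) hne
    · have hpos : 0 < |θ - θ'| := abs_pos.2 (by linarith)
      exact ⟨lt_max_of_lt_left (by linarith), by linarith [min_le_right θ θ']⟩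
    · have hpos : 0 < |θ - θ'| := abs_pos.2 (by linarith)
      exact ⟨lt_max_of_lt_right (by linarith), by linarith [min_le_left θ θ']⟩
    · exact absurd ((lineClass_of_nonneg h).trans (lineClass_of_nonneg h').symm) hne
  have hupper : j < N (max θ θ').toNNReal ω :=
    lt_of_claimTime_lt hmono hj (Real.lt_toNNReal_iff_coe_lt.2 hcross.1)
  have hlower : N (min θ θ' - |θ - θ'|).toNNReal ω ≤ j := by
    by_contra! hlt
    rcases le_or_gt (min θ θ' - |θ - θ'|) 0 with hle | hpos
    · rw [Real.toNNReal_of_nonpos hle] at hlt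
      exact hlt.not_ge h0
    · exact ((Real.le_toNNReal_iff_coe_le hpos.le).1 (claimTime_le hlt)).not_gt hcross.2
  rw [crossingCount]
  omega

theorem abs_charWealth_sub_le (hC : C.HasBoundedDrift c) (hmono : Monotone fun t => N t ω) :
    |C.charWealth N Y b T t q ω - C.charWealth N Y b T t q' ω| ≤
      charDist c q q' + C.deductibleBound * crossingCount N q.1 q'.1 ω := by
  refine (abs_wealth_stateAt_sub_le hC _ _ T).trans
    (charDist_charAfterClaims_le hC (by positivity) q q' _ fun j hj => ?_)
  by_cases hclass : lineClass (claimTime N (N t ω + j) ω - q.1) =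
      lineClass (claimTime N (N t ω + j) ω - q'.1)
  · rw [hclass, sub_self, abs_zero]
    positivity
  · have hcount : 1 ≤ crossingCount N q.1 q'.1 ω :=
      one_le_crossingCount hmono (le_add_right (hmono (zero_le (a := t))))
        (show N t ω + j < N T ω by omega) hclass
    exact (abs_deductible_sub_le _ _).trans
      (le_mul_of_one_le_right C.deductibleBound.2 (Nat.one_le_cast.2 hcount))

end TerminalWealth

/-! ### Expected terminal wealth -/

section ExpectedWealth

theorem HasBoundedDrift.measurable_charClaim {C : Contract} {c : ℝ≥0}
    (hC : C.HasBoundedDrift c) :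
    Measurable fun a : ℝ × ℝ × ℝ × ℝ × ℝ => C.charClaim a.1 a.2.1 a.2.2.1 a.2.2.2 := by
  have heq : (fun a : ℝ × ℝ × ℝ × ℝ × ℝ => C.charClaim a.1 a.2.1 a.2.2.1 a.2.2.2) = fun a =>
      if a.2.1 ≤ a.2.2.1 then (a.2.2.2.1, a.2.2.2.2 - a.2.1)
      else (a.1 + C.waiting, a.2.2.2.2 + C.lineGain (a.1 - a.2.2.2.1) - C.lineGain (-C.waiting)
        - min a.2.1 (if a.1 - a.2.2.2.1 < 0 then C.deductible .C2 else C.deductible .C1)) := by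
    funext a
    split_ifs with hle hneg
    · exact charClaim_of_le hle _
    · rw [charClaim_of_lt (not_le.1 hle), lineClass_of_neg hneg]
    · rw [charClaim_of_lt (not_le.1 hle), lineClass_of_nonneg (not_lt.1 hneg)]
  have hgain := hC.lipschitzWith_lineGain.continuous.measurable
  have hdeductible : Measurable fun a : ℝ × ℝ × ℝ × ℝ × ℝ =>
      if a.1 - a.2.2.2.1 < 0 then C.deductible .C2 else C.deductible .C1 :=
    Measurable.ite (measurableSet_lt (by fun_prop) (by fun_prop)) measurable_const measurable_const
  rw [heq]
  exact Measurable.ite (measurableSet_le (by fun_prop) (by fun_prop)) (by fun_prop) (by fun_prop)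

variable {C : Contract} {Ω : Type*} [MeasurableSpace Ω] {P : Measure Ω} {N : ℝ≥0 → Ω → ℕ}
  {Y : ℕ → Ω → ℝ} {ρ σ : ℝ≥0} {b : ℝ≥0 → Ω → ℝ≥0} {c T t t' : ℝ≥0} {q q' : ℝ × ℝ}

theorem measurable_charAfterClaims (hC : C.HasBoundedDrift c) (hM : HasLinearClaimMeans N Y ρ σ P)
    (hb : Measurable (Function.uncurry b)) (n : ℕ) (q : ℝ × ℝ) (k : ℕ) :
    Measurable fun ω => C.charAfterClaims (fun j => claimTime N j ω) (fun j => Y j ω)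
      (fun v => b v ω) n q k := by
  induction k with
  | zero => exact measurable_const
  | succ k ih =>
    have hτ := measurable_claimTime hM.measurable_count hM.mono (n + k)
    have hβ : Measurable fun ω => b (claimTime N (n + k) ω) ω := hb.comp (hτ.prodMk measurable_id)
    exact hC.measurable_charClaim.comp (hτ.coe_nnreal_real.prodMk
      ((hM.measurable_size (n + k)).prodMk (hβ.coe_nnreal_real.prodMk ih)))

theorem measurable_charWealth (hC : C.HasBoundedDrift c) (hM : HasLinearClaimMeans N Y ρ σ P)
    (hb : Measurable (Function.uncurry b)) (T t : ℝ≥0) (q : ℝ × ℝ) :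
    Measurable (C.charWealth N Y b T t q) := by
  have hcount : Measurable fun a : Ω × ℕ × ℕ => C.charAfterClaims (fun j => claimTime N j a.1)
      (fun j => Y j a.1) (fun v => b v a.1) a.2.1 q (a.2.2 - a.2.1) :=
    measurable_from_prod_countable_left fun n =>
      measurable_charAfterClaims hC hM hb n.1 q (n.2 - n.1)
  have hchar := hcount.comp
    (measurable_id.prodMk ((hM.measurable_count t).prodMk (hM.measurable_count T)))
  exact hchar.snd.add
    (hC.lipschitzWith_lineGain.continuous.measurable.comp (hchar.fst.const_sub (T : ℝ)))

theorem integrable_charWealth [IsFiniteMeasure P] (hC : C.HasBoundedDrift c) (hw : 0 < C.waiting)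
    (hM : HasLinearClaimMeans N Y ρ σ P) (hb : Measurable (Function.uncurry b)) (ht : t ≤ T)
    (hq : q.1 ∈ Icc (0 : ℝ) (T + C.waiting)) : Integrable (C.charWealth N Y b T t q) P := by
  have hdiff : Integrable (fun ω => C.charWealth N Y b T t q ω - (C.stateAt q T).wealth) P := by
    refine (hM.integrable_claimLoad (C.claimEffect c T) ht).mono'
      ((measurable_charWealth hC hM hb T t q).sub_const _).aestronglyMeasurable
      (.of_forall fun ω => ?_)
    have := abs_charWealth_time_sub_le (Y := Y) (b := b) hC hw (hM.mono ω) ht le_rfl hq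
    rwa [charWealth_self] at this
  exact (integrable_add_const_iff (c := -(C.stateAt q T).wealth)).1 hdiff

theorem claimEffect_nonneg (hw : 0 < C.waiting) : 0 ≤ C.claimEffect c T := by
  rw [claimEffect]
  positivity

theorem integral_abs_charWealth_time_sub_le (hC : C.HasBoundedDrift c) (hw : 0 < C.waiting)
    (hM : HasLinearClaimMeans N Y ρ σ P) (htt' : t ≤ t') (ht' : t' ≤ T)
    (hq : q.1 ∈ Icc (0 : ℝ) (T + C.waiting)) :
    ∫ ω, |C.charWealth N Y b T t q ω - C.charWealth N Y b T t' q ω| ∂P ≤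
      (σ + ρ * C.claimEffect c T) * (t' - t) := by
  exact (integral_mono_of_nonneg (.of_forall fun _ => abs_nonneg _)
    (hM.integrable_claimLoad _ htt') (.of_forall fun ω =>
      abs_charWealth_time_sub_le hC hw (hM.mono ω) htt' ht' hq)).trans
    (hM.integral_claimLoad_le (claimEffect_nonneg hw) htt')

theorem crossing_start_le (θ θ' : ℝ) :
    (min θ θ' - |θ - θ'|).toNNReal ≤ (max θ θ').toNNReal :=
  Real.toNNReal_le_toNNReal
    ((sub_le_self _ (abs_nonneg _)).trans (min_le_max (a := θ) (b := θ')))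

theorem integrable_crossingCount (hM : HasLinearClaimMeans N Y ρ σ P) (θ θ' : ℝ) :
    Integrable (fun ω => (crossingCount N θ θ' ω : ℝ)) P :=
  hM.integrable_count_sub (crossing_start_le θ θ')

theorem integral_crossingCount_le (hM : HasLinearClaimMeans N Y ρ σ P) (θ θ' : ℝ) :
    ∫ ω, (crossingCount N θ θ' ω : ℝ) ∂P ≤ ρ * (2 * |θ - θ'|) := by
  refine (hM.integral_count_sub_le (crossing_start_le θ θ')).trans ?_
  gcongr
  rw [Real.coe_toNNReal', Real.coe_toNNReal']
  refine (max_sub_max_le_max _ _ _ _).trans (max_le (le_of_eq ?_) (by simp))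
  rw [← max_sub_min_eq_abs']
  ring

theorem integral_abs_charWealth_sub_le [IsProbabilityMeasure P] (hC : C.HasBoundedDrift c)
    (hM : HasLinearClaimMeans N Y ρ σ P) :
    ∫ ω, |C.charWealth N Y b T t q ω - C.charWealth N Y b T t q' ω| ∂P ≤
      charDist c q q' + C.deductibleBound * (ρ * (2 * |q.1 - q'.1|)) := by
  have hcount : Integrable (fun ω => C.deductibleBound * (crossingCount N q.1 q'.1 ω : ℝ)) P :=
    (integrable_crossingCount hM q.1 q'.1).const_mul _
  calc _ ≤ ∫ ω, (charDist c q q' + C.deductibleBound * (crossingCount N q.1 q'.1 ω : ℝ)) ∂P :=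
        integral_mono_of_nonneg (.of_forall fun _ => abs_nonneg _)
          ((integrable_const _).add hcount)
          (.of_forall fun ω => abs_charWealth_sub_le hC (hM.mono ω))
    _ = charDist c q q' + C.deductibleBound * ∫ ω, (crossingCount N q.1 q'.1 ω : ℝ) ∂P := by
        rw [integral_add (integrable_const _) hcount, integral_const_mul]
        simp
    _ ≤ _ := by
        gcongr
        exact integral_crossingCount_le hM q.1 q'.1

end ExpectedWealth

end Contract

/-! ### Lipschitz continuity of the value -/

section LipschitzExpectations

variable {Ω : Type*} [MeasurableSpace Ω] {P : Measure Ω} {h : ℝ → ℝ} {L : ℝ≥0} {X X' : Ω → ℝ}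

theorem integrable_comp_of_lipschitzWith [IsFiniteMeasure P] (hh : LipschitzWith L h)
    (hX : Integrable X P) : Integrable (fun ω => h (X ω)) P := by
  refine ((hX.norm.const_mul (L : ℝ)).add (integrable_const ‖h 0‖)).mono'
    (hh.continuous.comp_aestronglyMeasurable hX.aestronglyMeasurable) (.of_forall fun ω => ?_)
  have hdist := hh.norm_sub_le (X ω) 0
  rw [sub_zero] at hdist
  exact (norm_le_norm_sub_add _ (h 0)).trans (add_le_add_left hdist _)

theorem abs_integral_comp_sub_le [IsFiniteMeasure P] (hh : LipschitzWith L h)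
    (hX : Integrable X P) (hX' : Integrable X' P) :
    |∫ ω, h (X ω) ∂P - ∫ ω, h (X' ω) ∂P| ≤ L * ∫ ω, |X ω - X' ω| ∂P := by
  rw [← integral_sub (integrable_comp_of_lipschitzWith hh hX)
    (integrable_comp_of_lipschitzWith hh hX'), ← integral_const_mul]
  exact norm_integral_le_of_norm_le ((hX.sub hX').abs.const_mul _)
    (.of_forall fun ω => hh.norm_sub_le _ _)

theorem lipschitzOnWith_sSup_image {α β : Type*} [PseudoMetricSpace α] {K : ℝ≥0} {s : Set α}
    {S : Set β} {F : α → β → ℝ} (hS : S.Nonempty) (hbdd : ∀ p ∈ s, BddAbove (F p '' S))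
    (hF : ∀ b ∈ S, LipschitzOnWith K (fun p => F p b) s) :
    LipschitzOnWith K (fun p => sSup (F p '' S)) s := by
  refine LipschitzOnWith.of_le_add_mul K fun p hp p' hp' => csSup_le (hS.image _) ?_
  rintro _ ⟨b, hb, rfl⟩
  calc F p b ≤ F p' b + K * dist p p' := (hF b hb).le_add_mul hp hp'
    _ ≤ sSup (F p' '' S) + K * dist p p' := by
        gcongr
        exact le_csSup (hbdd p' hp') (mem_image_of_mem _ hb)

end LipschitzExpectations

namespace Contract

section Payoff

variable {C : Contract} {Ω : Type*} [MeasurableSpace Ω] {P : Measure Ω}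
  {N : ℝ≥0 → Ω → ℕ} {Y : ℕ → Ω → ℝ} {ρ σ : ℝ≥0} {b : ℝ≥0 → Ω → ℝ≥0} {c T : ℝ≥0}
  {i : InsClass} {h : ℝ → ℝ} {L : ℝ≥0}

theorem integrable_terminalWealth [IsFiniteMeasure P] (hC : C.HasBoundedDrift c)
    (hw : 0 < C.waiting) (hM : HasLinearClaimMeans N Y ρ σ P)
    (hb : Measurable (Function.uncurry b)) {p : ℝ≥0 × ℝ × ℝ} (hp : p ∈ C.domain T i) :
    Integrable (C.terminalWealth N Y T i p.1 p.2.1 p.2.2 b) P := by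
  rw [terminalWealth_eq_charWealth hC hw hM.mono hp]
  exact integrable_charWealth hC hw hM hb hp.2.2.1 (characteristic_fst_mem_Icc hw hp)

theorem bddAbove_payoff [IsProbabilityMeasure P] (hC : C.HasBoundedDrift c)
    (hw : 0 < C.waiting) (hM : HasLinearClaimMeans N Y ρ σ P) {𝓑 : Set (ℝ≥0 → Ω → ℝ≥0)}
    (h𝓑 : ∀ b ∈ 𝓑, Measurable (Function.uncurry b)) (hh : LipschitzWith L h)
    {p : ℝ≥0 × ℝ × ℝ} (hp : p ∈ C.domain T i) :
    BddAbove (C.payoff P N Y T h i p.1 p.2.1 p.2.2 '' 𝓑) := by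
  have hq := characteristic_fst_mem_Icc hw hp
  set q := C.characteristic p.1 ⟨i, p.2.1, p.2.2⟩ with hq_def
  refine ⟨h (C.stateAt q T).wealth + L * ((σ + ρ * C.claimEffect c T) * (T - p.1)), ?_⟩
  rintro _ ⟨b, hb, rfl⟩
  have hsub := (abs_integral_comp_sub_le hh
    (integrable_charWealth hC hw hM (h𝓑 b hb) hp.2.2.1 hq)
    (integrable_charWealth hC hw hM (h𝓑 b hb) le_rfl hq)).trans
    (mul_le_mul_of_nonneg_left
      (integral_abs_charWealth_time_sub_le hC hw hM hp.2.2.1 le_rfl hq) L.2)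
  simp only [charWealth_self, integral_const, probReal_univ, one_smul] at hsub
  rw [payoff, terminalWealth_eq_charWealth hC hw hM.mono hp, ← hq_def]
  exact sub_le_iff_le_add'.1 ((le_abs_self _).trans hsub)

theorem integral_abs_terminalWealth_sub_le [IsProbabilityMeasure P] (hC : C.HasBoundedDrift c)
    (hw : 0 < C.waiting) (hM : HasLinearClaimMeans N Y ρ σ P) (hb : Measurable (Function.uncurry b))
    {p p' : ℝ≥0 × ℝ × ℝ} (hp : p ∈ C.domain T i) (hp' : p' ∈ C.domain T i) (hle : p.1 ≤ p'.1) :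
    ∫ ω, |C.terminalWealth N Y T i p.1 p.2.1 p.2.2 b ω
        - C.terminalWealth N Y T i p'.1 p'.2.1 p'.2.2 b ω| ∂P ≤
      (1 + 3 * c + 4 * ρ * C.deductibleBound + (σ + ρ * C.claimEffect c T)) * dist p p' := by
  have hq := characteristic_fst_mem_Icc hw hp
  have hq' := characteristic_fst_mem_Icc hw hp'
  have hclock := abs_characteristic_fst_sub_le (C := C) (i := i) p p'
  have hdist := charDist_characteristic_le (i := i) hC p p'
  have htime : (p'.1 : ℝ) - p.1 ≤ dist p p' :=
    (le_abs_self _).trans ((abs_sub_comm _ _).trans_le (le_max_left _ _))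
  rw [terminalWealth_eq_charWealth hC hw hM.mono hp, terminalWealth_eq_charWealth hC hw hM.mono hp']
  set q := C.characteristic p.1 ⟨i, p.2.1, p.2.2⟩
  set q' := C.characteristic p'.1 ⟨i, p'.2.1, p'.2.2⟩
  set W : ℝ≥0 → ℝ × ℝ → Ω → ℝ := C.charWealth N Y b T
  have hW : Integrable (W p.1 q) P := integrable_charWealth hC hw hM hb hp.2.2.1 hq
  have hW' : Integrable (W p.1 q') P := integrable_charWealth hC hw hM hb hp.2.2.1 hq'
  have hW'' : Integrable (W p'.1 q') P := integrable_charWealth hC hw hM hb hp'.2.2.1 hq'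
  have heffect : 0 ≤ C.claimEffect c T := claimEffect_nonneg hw
  calc ∫ ω, |W p.1 q ω - W p'.1 q' ω| ∂P
      ≤ ∫ ω, (|W p.1 q ω - W p.1 q' ω| + |W p.1 q' ω - W p'.1 q' ω|) ∂P :=
        integral_mono (hW.sub hW'').abs ((hW.sub hW').abs.add (hW'.sub hW'').abs)
          fun ω => abs_sub_le _ _ _
    _ = (∫ ω, |W p.1 q ω - W p.1 q' ω| ∂P) + ∫ ω, |W p.1 q' ω - W p'.1 q' ω| ∂P :=
        integral_add (hW.sub hW').abs (hW'.sub hW'').abs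
    _ ≤ (charDist c q q' + C.deductibleBound * (ρ * (2 * |q.1 - q'.1|)))
        + (σ + ρ * C.claimEffect c T) * (p'.1 - p.1) :=
        add_le_add (integral_abs_charWealth_sub_le hC hM)
          (integral_abs_charWealth_time_sub_le hC hw hM hle hp'.2.2.1 hq')
    _ ≤ ((1 + 3 * c) * dist p p' + C.deductibleBound * (ρ * (2 * (2 * dist p p'))))
        + (σ + ρ * C.claimEffect c T) * dist p p' := by gcongr
    _ = _ := by ring

theorem exists_lipschitzOnWith_payoff [IsProbabilityMeasure P] (hC : C.HasBoundedDrift c)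
    (hw : 0 < C.waiting) (hM : HasLinearClaimMeans N Y ρ σ P) (T : ℝ≥0) (i : InsClass)
    (hh : LipschitzWith L h) :
    ∃ K : ℝ≥0, ∀ b : ℝ≥0 → Ω → ℝ≥0, Measurable (Function.uncurry b) →
      LipschitzOnWith K (fun p => C.payoff P N Y T h i p.1 p.2.1 p.2.2 b) (C.domain T i) := by
  let M : ℝ := 1 + 3 * c + 4 * ρ * C.deductibleBound + (σ + ρ * C.claimEffect c T)
  refine ⟨L * M.toNNReal, fun b hb => LipschitzOnWith.of_dist_le_mul fun p hp p' hp' => ?_⟩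
  have hordered : ∀ {p p'}, p ∈ C.domain T i → p' ∈ C.domain T i → p.1 ≤ p'.1 →
      dist (C.payoff P N Y T h i p.1 p.2.1 p.2.2 b) (C.payoff P N Y T h i p'.1 p'.2.1 p'.2.2 b) ≤
        L * M.toNNReal * dist p p' := by
    intro p p' hp hp' hle
    refine (abs_integral_comp_sub_le hh (integrable_terminalWealth hC hw hM hb hp)
      (integrable_terminalWealth hC hw hM hb hp')).trans ?_
    rw [mul_assoc]
    gcongr
    exact (integral_abs_terminalWealth_sub_le hC hw hM hb hp hp' hle).trans
      (mul_le_mul_of_nonneg_right (Real.le_coe_toNNReal M) dist_nonneg)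
  rw [NNReal.coe_mul]
  rcases le_total p.1 p'.1 with hle | hle
  · exact hordered hp hp' hle
  · rw [dist_comm, dist_comm p]
    exact hordered hp' hp hle

end Payoff

end Contract

end BonusMalus

theorem mainTheorem3_general {Ω : Type*} [MeasurableSpace Ω] {P : Measure Ω}
    [IsProbabilityMeasure P] {N : ℝ≥0 → Ω → ℕ} {Y : ℕ → Ω → ℝ} {ρ σ : ℝ≥0}
    (hM : BonusMalus.HasLinearClaimMeans N Y ρ σ P)
    {𝓑 : Set (ℝ≥0 → Ω → ℝ≥0)} (h𝓑 : 𝓑.Nonempty)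
    (h𝓑meas : ∀ b ∈ 𝓑, Measurable (Function.uncurry b)) (T : ℝ≥0)
    {C : BonusMalus.Contract} {c : ℝ≥0} (hC : C.HasBoundedDrift c) (hwaiting : 0 < C.waiting)
    {h : ℝ → ℝ} {L : ℝ≥0} (hh : LipschitzWith L h) :
    (∀ i, ∀ p ∈ C.domain T i,
      (∀ b ∈ 𝓑, Integrable (fun ω => h (C.terminalWealth N Y T i p.1 p.2.1 p.2.2 b ω)) P) ∧
      (C.payoff P N Y T h i p.1 p.2.1 p.2.2 '' 𝓑).Nonempty ∧
      BddAbove (C.payoff P N Y T h i p.1 p.2.1 p.2.2 '' 𝓑)) ∧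
    ∀ i, ∃ K : ℝ≥0, LipschitzOnWith K
      (fun p : ℝ≥0 × ℝ × ℝ => sSup (C.payoff P N Y T h i p.1 p.2.1 p.2.2 '' 𝓑))
      (C.domain T i) := by
  have hbdd : ∀ i, ∀ p ∈ C.domain T i, BddAbove (C.payoff P N Y T h i p.1 p.2.1 p.2.2 '' 𝓑) :=
    fun _ _ hp => BonusMalus.Contract.bddAbove_payoff hC hwaiting hM h𝓑meas hh hp
  refine ⟨fun i p hp => ⟨fun b hb => ?_, h𝓑.image _, hbdd i p hp⟩, fun i => ?_⟩
  · exact BonusMalus.integrable_comp_of_lipschitzWith hh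
      (BonusMalus.Contract.integrable_terminalWealth hC hwaiting hM (h𝓑meas b hb) hp)
  · obtain ⟨K, hK⟩ :=
      BonusMalus.Contract.exists_lipschitzOnWith_payoff hC hwaiting hM T i hh
    exact ⟨K, BonusMalus.lipschitzOnWith_sSup_image h𝓑 (hbdd i) fun b hb => hK b (h𝓑meas b hb)⟩

theorem mainTheorem3 {Ω : Type*} [MeasurableSpace Ω] (P : Measure Ω) [IsProbabilityMeasure P]
    (N : ℝ≥0 → Ω → ℕ) (Y : ℕ → Ω → ℝ) (rate : ℝ≥0) (hrate : 0 < rate)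
    (hM : BonusMalus.IsClaimModel N Y rate P)
    (T : ℝ≥0) (hT : 0 < T)
    (C : BonusMalus.Contract)
    (hwaiting : 0 < C.waiting)
    (hdeductible : ∀ i, 0 ≤ C.deductible i)
    (hmeas : ∀ i, Measurable fun s => C.premium i s (C.deductible i))
    (hnonneg : ∀ i s, 0 ≤ s → 0 ≤ C.premium i s (C.deductible i))
    (hincome : ∀ i s, 0 ≤ s → C.premium i s (C.deductible i) < C.income)
    (h : ℝ → ℝ) (L : ℝ≥0) (hh : LipschitzWith L h) :
    -- the value function is well defined and finite
    (∀ i, ∀ p ∈ C.domain T i,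
      (∀ b ∈ BonusMalus.barrierStrategies hM,
        Integrable (fun ω => h (C.terminalWealth N Y T i p.1 p.2.1 p.2.2 b ω)) P) ∧
      (C.payoff P N Y T h i p.1 p.2.1 p.2.2 '' BonusMalus.barrierStrategies hM).Nonempty ∧
      BddAbove (C.payoff P N Y T h i p.1 p.2.1 p.2.2 '' BonusMalus.barrierStrategies hM)) ∧
    -- and Lipschitz continuous jointly in time, time since the last report, and wealth
    ∀ i, ∃ K : ℝ≥0, LipschitzOnWith K
      (fun p : ℝ≥0 × ℝ × ℝ => C.value hM T h i p.1 p.2.1 p.2.2) (C.domain T i) :=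
  mainTheorem3_general hM.hasLinearClaimMeans ⟨_, BonusMalus.zero_mem_barrierStrategies hM⟩
    (fun _ hb => BonusMalus.measurable_uncurry_of_mem_barrierStrategies hb) T
    (BonusMalus.Contract.hasBoundedDrift_income hmeas hnonneg hincome) hwaiting hh
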